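/- Graphs are finite and may have loops and parallel edges. For a graph $G=(V,E,\phi)$ put $\Delta(G)=|E(G)|-|V(G)|$, and for $X\subseteq E(G)$ let $G\langle X\rangle$ be the subgraph of $G$ formed by the edges in $X$ and their end vertices. A graph is a \emph{cacti-graph} if it has no isolated vertices, no leaves (vertices of degree one, a loop counting twice), and no component that is a cycle (a vertex with one loop, or two vertices joined by two parallel edges, being cycles). For an integer $k\ge 1$ the \emph{$k$-circular matroid} $M_k(G)$ is the matroid on $E(G)$ whose circuits are the sets $C\subseteq E(G)$ such that $\Delta(G\langle C\rangle)=k$ and $G\langle C\rangle$ is a cacti-graph. For a vertex $x$, $S(x,G)$ is the set of edges incident to $x$, $\mathcal S(G)=\{S(x,G):x\in V(G)\}$, and $G\setminus x$ is obtained from $G$ by deleting $x$ and all edges incident to $x$. Graphs $G=(V,E,\phi)$ and $G'=(V',E',\phi')$ are \emph{strongly isomorphic} if $E=E'$ and there is a bijection $\nu:V\to V'$ such that $\phi(e)=\{x,y\}\Leftrightarrow\phi'(e)=\{\nu(x),\nu(y)\}$ for all $e\in E$ and $x,y\in V$. \textbf{Theorem.} Let $k\ge 2$, and let $G$ and $G'$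 be graphs, where $G'$ has no isolated vertices. Suppose that (a1) $\Delta(G)\ge k$ and $G$ is a cacti-graph, (a2) $\Delta(G\setminus x)\ge k$ and $G\setminus x$ is a cacti-graph for every vertex $x$ of $G$, and (a3) $M_k(G')=M_k(G)$. Then $\mathcal S(G)=\mathcal S(G')$, and $G$ and $G'$ are strongly isomorphic. -/

import Mathlib

open scoped Graph

namespace Graph

variable {α α' β : Type*}

/-! ### Basic notions for finite graphs (loops and parallel edges are allowed) -/

/-- The degree of a vertex in a finite graph; every loop counts twice. -/
noncomputable def degree (G : Graph α β) (v : α) : ℕ :=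
  (G.incidenceSet v).ncard + (G.loopSet v).ncard

/-- `v` is an isolated vertex: no edge is incident to it. -/
def IsIsolated (G : Graph α β) (v : α) : Prop :=
  v ∈ V(G) ∧ G.incidenceSet v = ∅

/-- `v` is a leaf: a vertex of degree one. -/
def IsLeaf (G : Graph α β) (v : α) : Prop :=
  v ∈ V(G) ∧ G.degree v = 1

/-- `w` can be reached from `v` along edges of the graph. -/
def Reachable (G : Graph α β) (v w : α) : Prop :=
  Relation.ReflTransGen G.Adj v w

/-- The component of `G` containing the vertex `v`. -/
def component (G : Graph α β) (v : α) : Graph α β :=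
  G.induce {w | w ∈ V(G) ∧ G.Reachable v w}

/-- A finite graph is a cycle if it is non-empty, connected, and 2-regular (a vertex with a single
loop and a pair of parallel edges are cycles). -/
def IsCycleGraph (H : Graph α β) : Prop :=
  V(H).Nonempty ∧ (∀ v ∈ V(H), ∀ w ∈ V(H), H.Reachable v w) ∧ ∀ v ∈ V(H), H.degree v = 2

/-- A cacti-graph: no isolated vertices, no leaves, no cycle components. -/
def IsCactiGraph (G : Graph α β) : Prop :=
  (∀ v, ¬ G.IsIsolated v) ∧ (∀ v, ¬ G.IsLeaf v) ∧ ∀ v ∈ V(G), ¬ (G.component v).IsCycleGraph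

/-- `Δ(G) = |E(G)| - |V(G)|`. -/
noncomputable def excess (G : Graph α β) : ℤ :=
  (E(G).ncard : ℤ) - (V(G).ncard : ℤ)

/-- The subgraph `G⟨X⟩` of `G` induced by the edges in `X`: its vertices are the ends of the
edges in `X`. -/
def edgeInduce (G : Graph α β) (X : Set β) : Graph α β :=
  (G.restrict X).induce {v | ∃ e ∈ X, G.Inc e v}

/-- The set `S(G)` of vertex stars of `G`. -/
def vertexStars (G : Graph α β) : Set (Set β) :=
  {S | ∃ v ∈ V(G), S = G.incidenceSet v}

/-- Strong isomorphism: the edge sets are equal, and some bijection of the vertex sets preserves the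
ends of every edge. -/
def StronglyIsomorphic (G : Graph α β) (G' : Graph α' β) : Prop :=
  E(G) = E(G') ∧ ∃ ν : V(G) ≃ V(G'), ∀ (e : β) (x y : V(G)),
    G.IsLink e x y ↔ G'.IsLink e (ν x) (ν y)

/-- The family `C_k(G)`: sets `C` of edges such that `Δ(G⟨C⟩) = k` and `G⟨C⟩` is a cacti-graph. -/
def kCircuits (G : Graph α β) (k : ℕ) : Set (Set β) :=
  {C | C ⊆ E(G) ∧ (G.edgeInduce C).excess = k ∧ (G.edgeInduce C).IsCactiGraph}

/-! ### `C_k(G)` is the family of circuits of a matroid on `E(G)` -/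

section Aux

variable {G : Graph α β} {X Y Z : Set β} {k : ℕ}

lemma edgeInduce_vertexSet (G : Graph α β) (X : Set β) :
    V(G.edgeInduce X) = {v | ∃ e ∈ X, G.Inc e v} := rfl

lemma edgeInduce_isLink {e : β} {x y : α} :
    (G.edgeInduce X).IsLink e x y ↔ G.IsLink e x y ∧ e ∈ X := by
  simp only [edgeInduce, induce_isLink, restrict_isLink, Set.mem_ofPred_eq]
  constructor
  · tauto
  · rintro ⟨h, he⟩
    exact ⟨⟨he, h⟩, ⟨e, he, h.inc_left⟩, ⟨e, he, h.inc_right⟩⟩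

lemma edgeInduce_inc {e : β} {x : α} : (G.edgeInduce X).Inc e x ↔ G.Inc e x ∧ e ∈ X := by
  simp [Inc, edgeInduce_isLink]

lemma edgeInduce_edgeSet (hX : X ⊆ E(G)) : E(G.edgeInduce X) = X := by
  ext e
  rw [edge_mem_iff_exists_isLink]
  simp only [edgeInduce_isLink]
  constructor
  · rintro ⟨x, y, -, h⟩; exact h
  · intro h
    obtain ⟨x, y, hxy⟩ := exists_isLink_of_mem_edgeSet (hX h)
    exact ⟨x, y, hxy, h⟩

lemma finite_ends (G : Graph α β) (e : β) : {v | G.Inc e v}.Finite := by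
  by_cases he : e ∈ E(G)
  · obtain ⟨x, y, hxy⟩ := exists_isLink_of_mem_edgeSet he
    exact (Set.toFinite {x, y}).subset fun v hv => hv.eq_or_eq_of_isLink hxy
  · convert Set.finite_empty
    ext v
    simp [not_inc_of_notMem_edgeSet he]

lemma edgeInduce_vertexSet_finite (G : Graph α β) (hX : X.Finite) : V(G.edgeInduce X).Finite := by
  have : V(G.edgeInduce X) = ⋃ e ∈ X, {v | G.Inc e v} := by
    ext v; simp [edgeInduce_vertexSet]
  rw [this]
  exact hX.biUnion fun e _ => G.finite_ends e

lemma edgeInduce_excess (hX : X ⊆ E(G)) :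
    (G.edgeInduce X).excess = (X.ncard : ℤ) - (V(G.edgeInduce X).ncard : ℤ) := by
  rw [excess, edgeInduce_edgeSet hX]

lemma edgeInduce_vertexSet_mono (h : X ⊆ Y) : V(G.edgeInduce X) ⊆ V(G.edgeInduce Y) := by
  rintro v ⟨e, he, hv⟩
  exact ⟨e, h he, hv⟩

lemma excess_empty : (G.edgeInduce ∅).excess = 0 := by
  rw [edgeInduce_excess (Set.empty_subset _)]
  simp [edgeInduce_vertexSet]

lemma excess_supermodular (hE : E(G).Finite) (hX : X ⊆ E(G)) (hY : Y ⊆ E(G)) :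
    (G.edgeInduce X).excess + (G.edgeInduce Y).excess ≤
      (G.edgeInduce (X ∪ Y)).excess + (G.edgeInduce (X ∩ Y)).excess := by
  have fX := hE.subset hX
  have fY := hE.subset hY
  rw [edgeInduce_excess hX, edgeInduce_excess hY, edgeInduce_excess (Set.union_subset hX hY),
    edgeInduce_excess (Set.inter_subset_left.trans hX)]
  have h1 := Set.ncard_union_add_ncard_inter X Y fX fY
  have gX := G.edgeInduce_vertexSet_finite fX
  have gY := G.edgeInduce_vertexSet_finite fY
  have h2 := Set.ncard_union_add_ncard_inter _ _ gX gY
  have h3 : V(G.edgeInduce (X ∪ Y)) = V(G.edgeInduce X) ∪ V(G.edgeInduce Y) := by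
    ext v
    simp only [edgeInduce_vertexSet, Set.mem_ofPred_eq, Set.mem_union]
    constructor
    · rintro ⟨e, h | h, hv⟩
      exacts [Or.inl ⟨e, h, hv⟩, Or.inr ⟨e, h, hv⟩]
    · rintro (⟨e, h, hv⟩ | ⟨e, h, hv⟩)
      exacts [⟨e, Or.inl h, hv⟩, ⟨e, Or.inr h, hv⟩]
  have h4 : V(G.edgeInduce (X ∩ Y)).ncard ≤ (V(G.edgeInduce X) ∩ V(G.edgeInduce Y)).ncard :=
    Set.ncard_le_ncard (Set.subset_inter (edgeInduce_vertexSet_mono Set.inter_subset_left)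
      (edgeInduce_vertexSet_mono Set.inter_subset_right)) (gX.inter_of_left _)
  rw [h3]
  omega

lemma excess_le_of_subset (hE : E(G).Finite) (hY : Y ⊆ E(G)) (h : Z ⊆ Y) :
    (G.edgeInduce Y).excess ≤ (G.edgeInduce Z).excess + ((Y \ Z).ncard : ℤ) := by
  have fY := hE.subset hY
  rw [edgeInduce_excess hY, edgeInduce_excess (h.trans hY)]
  have h1 := Set.ncard_sdiff_add_ncard_of_subset h fY
  have h2 := Set.ncard_le_ncard (edgeInduce_vertexSet_mono (G := G) h)
    (G.edgeInduce_vertexSet_finite fY)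
  omega

/-- Double counting of the incidences between a vertex set `W` and the edges meeting `W`. -/
lemma sum_degree (W : Finset α) {S : Finset β}
    (hS : ∀ e, e ∈ S ↔ ∃ v ∈ W, G.Inc e v) :
    ∑ v ∈ W, G.degree v ≤ 2 * S.card ∧
      ((∀ e v w, G.IsLink e v w → v ∈ W → w ∈ W) ↔ ∑ v ∈ W, G.degree v = 2 * S.card) := by
  classical
  have key : ∑ v ∈ W, G.degree v =
      ∑ e ∈ S, ((W.filter fun v => G.Inc e v).card + (W.filter fun v => G.IsLoopAt e v).card) := by
    rw [Finset.sum_add_distrib]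
    simp only [Finset.card_filter]
    rw [Finset.sum_comm, Finset.sum_comm (s := S) (t := W) (f := fun e v =>
      if G.IsLoopAt e v then 1 else 0), ← Finset.sum_add_distrib]
    refine Finset.sum_congr rfl fun v hv => ?_
    simp only [← Finset.card_filter]
    rw [degree, ← Set.ncard_coe_finset, ← Set.ncard_coe_finset]
    congr 2
    · ext e
      simp only [mem_incidenceSet, Finset.coe_filter, Set.mem_ofPred_eq]
      exact ⟨fun h => ⟨(hS e).2 ⟨v, hv, h⟩, h⟩, fun h => h.2⟩
    · ext e
      simp only [mem_loopSet, Finset.coe_filter, Set.mem_ofPred_eq]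
      exact ⟨fun h => ⟨(hS e).2 ⟨v, hv, h.inc⟩, h⟩, fun h => h.2⟩
  have each : ∀ e ∈ S,
      (W.filter fun v => G.Inc e v).card + (W.filter fun v => G.IsLoopAt e v).card ≤ 2 ∧
      ((∀ v w, G.IsLink e v w → v ∈ W → w ∈ W) ↔
        (W.filter fun v => G.Inc e v).card + (W.filter fun v => G.IsLoopAt e v).card = 2) := by
    intro e he
    obtain ⟨x, hx, y, hxy⟩ := (hS e).1 he
    by_cases hyx : y = x
    · subst hyx
      have e1 : (W.filter fun v => G.Inc e v) = {y} := by
        ext v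
        simp only [Finset.mem_filter, Finset.mem_singleton]
        constructor
        · rintro ⟨-, h⟩; simpa using h.eq_or_eq_of_isLink hxy
        · rintro rfl; exact ⟨hx, hxy.inc_left⟩
      have e2 : (W.filter fun v => G.IsLoopAt e v) = {y} := by
        ext v
        simp only [Finset.mem_filter, Finset.mem_singleton]
        constructor
        · rintro ⟨-, h⟩; simpa using h.inc.eq_or_eq_of_isLink hxy
        · rintro rfl; exact ⟨hx, hxy⟩
      rw [e1, e2]
      simp only [Finset.card_singleton, Nat.reduceAdd, le_refl, iff_true, true_and]
      intro v w h _
      have : w = y := by simpa using h.inc_right.eq_or_eq_of_isLink hxy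
      rwa [this]
    · have e2 : (W.filter fun v => G.IsLoopAt e v) = ∅ := by
        ext v
        simp only [Finset.mem_filter, Finset.notMem_empty, iff_false, not_and]
        intro _ h
        have h1 := h.eq_of_inc hxy.inc_left
        have h2 := h.eq_of_inc hxy.inc_right
        exact hyx (h2.symm.trans h1)
      rw [e2]
      by_cases hy : y ∈ W
      · have e1 : (W.filter fun v => G.Inc e v) = {x, y} := by
          ext v
          simp only [Finset.mem_filter, Finset.mem_singleton, Finset.mem_insert]
          constructor
          · rintro ⟨-, h⟩; exact h.eq_or_eq_of_isLink hxy
          · rintro (rfl | rfl)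
            exacts [⟨hx, hxy.inc_left⟩, ⟨hy, hxy.inc_right⟩]
        rw [e1, Finset.card_pair (Ne.symm hyx)]
        simp only [Finset.card_empty, add_zero, le_refl, iff_true, true_and]
        intro v w h _
        rcases h.inc_right.eq_or_eq_of_isLink hxy with h | h <;> rwa [h]
      · have e1 : (W.filter fun v => G.Inc e v) = {x} := by
          ext v
          simp only [Finset.mem_filter, Finset.mem_singleton]
          constructor
          · rintro ⟨hv, h⟩
            rcases h.eq_or_eq_of_isLink hxy with h | h
            · exact h
            · exact absurd (h ▸ hv) hy
          · rintro rfl; exact ⟨hx, hxy.inc_left⟩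
        rw [e1]
        simp only [Finset.card_singleton, Finset.card_empty, add_zero, Nat.one_le_ofNat,
          OfNat.one_ne_ofNat, iff_false, true_and]
        intro h
        exact hy (h x y hxy hx)
  have two : 2 * S.card = ∑ e ∈ S, 2 := by simp [mul_comm]
  rw [key, two]
  refine ⟨Finset.sum_le_sum fun e he => (each e he).1, ?_⟩
  rw [Finset.sum_eq_sum_iff_of_le fun e he => (each e he).1]
  constructor
  · intro h e he
    exact (each e he).2.1 (h e)
  · intro h e v w hvw hv
    have he : e ∈ S := (hS e).2 ⟨v, hv, hvw.inc_left⟩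
    exact (each e he).2.2 (h e he) v w hvw hv

lemma component_isLink {v x y : α} {e : β} :
    (G.component v).IsLink e x y ↔ G.IsLink e x y ∧ G.Reachable v x := by
  simp only [component, induce_isLink, Set.mem_ofPred_eq]
  constructor
  · rintro ⟨h, ⟨-, hx⟩, -⟩; exact ⟨h, hx⟩
  · rintro ⟨h, hx⟩
    exact ⟨h, ⟨h.left_mem, hx⟩, ⟨h.right_mem, hx.tail ⟨e, h⟩⟩⟩

lemma component_degree {v w : α} (h : G.Reachable v w) : (G.component v).degree w = G.degree w := by
  have e1 : (G.component v).incidenceSet w = G.incidenceSet w := by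
    ext e
    simp [Inc, component_isLink, h]
  have e2 : (G.component v).loopSet w = G.loopSet w := by
    ext e
    simp [← isLink_self_iff, component_isLink, h]
  rw [degree, degree, e1, e2]

lemma Reachable.symm {v w : α} (h : G.Reachable v w) : G.Reachable w v := by
  induction h with
  | refl => exact .refl
  | tail _ h2 ih => exact Relation.ReflTransGen.head h2.symm ih

lemma component_reachable {v w : α} (h : G.Reachable v w) : (G.component v).Reachable v w := by
  induction h with
  | refl => exact .refl
  | tail h1 h2 ih =>
    obtain ⟨e, he⟩ := h2
    exact ih.tail ⟨e, component_isLink.2 ⟨he, h1⟩⟩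

lemma component_isCycleGraph_iff {v : α} (hv : v ∈ V(G)) :
    (G.component v).IsCycleGraph ↔ ∀ w, G.Reachable v w → G.degree w = 2 := by
  have mem : ∀ {w}, G.Reachable v w → w ∈ V(G) := by
    intro w h
    rcases Relation.ReflTransGen.cases_tail h with h | ⟨c, -, h⟩
    · exact h ▸ hv
    · exact h.right_mem
  constructor
  · rintro ⟨-, -, h⟩ w hw
    rw [← component_degree hw]
    exact h w ⟨mem hw, hw⟩
  · intro h
    refine ⟨⟨v, hv, .refl⟩, ?_, ?_⟩
    · rintro x ⟨-, hx⟩ y ⟨-, hy⟩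
      exact (component_reachable hx).symm.trans (component_reachable hy)
    · rintro w ⟨-, hw⟩
      rw [component_degree hw, h w hw]

lemma exists_minimal_excess (hE : E(G).Finite) (hX : X ⊆ E(G)) {n : ℤ}
    (h : n ≤ (G.edgeInduce X).excess) :
    ∃ C ⊆ X, n ≤ (G.edgeInduce C).excess ∧ ∀ D ⊂ C, (G.edgeInduce D).excess < n := by
  have fX := hE.subset hX
  obtain ⟨C, hC, hmin⟩ := (fX.finite_subsets.subset
    (t := {D | D ⊆ X ∧ n ≤ (G.edgeInduce D).excess}) (fun D hD => hD.1)).exists_le_minimal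
    (a := X) ⟨subset_rfl, h⟩
  refine ⟨C, hC, hmin.prop.2, fun D hD => ?_⟩
  by_contra hcon
  exact hD.not_subset (hmin.le_of_le ⟨hD.subset.trans hC, not_lt.1 hcon⟩ hD.subset)

lemma degree_eq_zero_iff (hE : E(G).Finite) {v : α} : G.degree v = 0 ↔ G.incidenceSet v = ∅ := by
  have f1 := hE.subset (G.incidenceSet_subset_edgeSet v)
  have f2 := f1.subset (G.loopSet_subset_incidenceSet v)
  rw [degree, Nat.add_eq_zero_iff, Set.ncard_eq_zero f1, Set.ncard_eq_zero f2]
  refine ⟨fun h => h.1, fun h => ⟨h, ?_⟩⟩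
  have := G.loopSet_subset_incidenceSet v
  rw [h] at this
  exact Set.subset_empty_iff.1 this

/-- The edge sets in `C_k(G)` are exactly the minimal edge sets of excess at least `k`. -/
lemma mem_kCircuits_iff (hE : E(G).Finite) (hk : 1 ≤ k) {C : Set β} (hC : C ⊆ E(G)) :
    C ∈ G.kCircuits k ↔
      (k : ℤ) ≤ (G.edgeInduce C).excess ∧ ∀ D ⊂ C, (G.edgeInduce D).excess < k := by
  classical
  have fC := hE.subset hC
  set H := G.edgeInduce C with hH
  have hEH : E(H) = C := edgeInduce_edgeSet hC
  have fEH : E(H).Finite := hEH ▸ fC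
  have fVH : V(H).Finite := G.edgeInduce_vertexSet_finite fC
  have hVH : ∀ v, v ∈ V(H) ↔ ∃ e ∈ C, G.Inc e v := fun v => Iff.rfl
  constructor
  · rintro ⟨-, hex, hiso, hleaf, hcyc⟩
    refine ⟨hex.ge, fun D hD => ?_⟩
    rw [← hH] at hex hiso hleaf hcyc
    by_contra hcon
    rw [not_lt, ← hex, hH, edgeInduce_excess hC, edgeInduce_excess (hD.subset.trans hC)] at hcon
    have fD := fC.subset hD.subset
    have hsub := edgeInduce_vertexSet_mono (G := G) hD.subset
    have c1 := Set.ncard_sdiff_add_ncard_of_subset hD.subset fC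
    have c2 := Set.ncard_sdiff_add_ncard_of_subset hsub fVH
    have c3 : (C \ D).ncard ≤ (V(H) \ V(G.edgeInduce D)).ncard := by
      rw [← hH] at c2 hcon
      omega
    set W := (fVH.sdiff (t := V(G.edgeInduce D))).toFinset with hW
    have memW : ∀ v, v ∈ W ↔ v ∈ V(H) ∧ v ∉ V(G.edgeInduce D) := by intro v; simp [hW]
    set S := fC.toFinset.filter fun e => ∃ v ∈ W, H.Inc e v with hS
    have memS : ∀ e, e ∈ S ↔ ∃ v ∈ W, H.Inc e v := by
      intro e
      simp only [hS, Finset.mem_filter, Set.Finite.mem_toFinset, and_iff_right_iff_imp]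
      rintro ⟨v, -, h⟩
      exact (edgeInduce_inc.1 h).2
    have hSsub : (S : Set β) ⊆ C \ D := by
      intro e he
      obtain ⟨v, hv, hev⟩ := (memS e).1 he
      refine ⟨(edgeInduce_inc.1 hev).2, fun heD => ((memW v).1 hv).2 ⟨e, heD, ?_⟩⟩
      exact (edgeInduce_inc.1 hev).1
    have c4 : S.card ≤ (C \ D).ncard := by
      rw [← Set.ncard_coe_finset]
      exact Set.ncard_le_ncard hSsub fC.sdiff
    have c5 : (V(H) \ V(G.edgeInduce D)).ncard = W.card := by
      rw [hW, Set.ncard_eq_toFinset_card _ (fVH.sdiff)]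
    have hdeg : ∀ v ∈ W, 2 ≤ H.degree v := by
      intro v hv
      have hvV := ((memW v).1 hv).1
      have h0 : H.degree v ≠ 0 := fun h => hiso v ⟨hvV, (degree_eq_zero_iff fEH).1 h⟩
      have h1 : H.degree v ≠ 1 := fun h => hleaf v ⟨hvV, h⟩
      omega
    obtain ⟨d1, d2⟩ := sum_degree W memS
    have d3 : ∑ v ∈ W, 2 ≤ ∑ v ∈ W, H.degree v := Finset.sum_le_sum hdeg
    have d4 : ∑ v ∈ W, 2 = 2 * W.card := by simp [mul_comm]
    have hclosed := d2.2 (by omega)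
    have heq : ∑ v ∈ W, 2 = ∑ v ∈ W, H.degree v := by omega
    rw [Finset.sum_eq_sum_iff_of_le hdeg] at heq
    have hpos : 0 < (C \ D).ncard := by
      rw [Set.ncard_pos fC.sdiff]
      exact Set.nonempty_of_ssubset hD
    obtain ⟨v, hv⟩ : W.Nonempty := by
      rw [← Finset.card_pos]; omega
    have hvV := ((memW v).1 hv).1
    refine hcyc v hvV ((component_isCycleGraph_iff hvV).2 fun w hw => ?_)
    have : w ∈ W := by
      induction hw with
      | refl => exact hv
      | tail _ h2 ih =>
        obtain ⟨e, he⟩ := h2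
        exact hclosed e _ _ he ih
    exact (heq w this).symm
  · rintro ⟨hge, hmin⟩
    -- if removing the edges of `T` removes at least `|T|` vertices, then `T` is empty
    have hrem : ∀ T ⊆ C, ∀ U ⊆ V(H), T.ncard ≤ U.ncard →
        (∀ e ∈ C \ T, ∀ u ∈ U, ¬ G.Inc e u) → T = ∅ := by
      intro T hT U hU hTU hno
      by_contra hne
      have hss : C \ T ⊂ C := by
        refine ⟨Set.sdiff_subset, fun h => ?_⟩
        obtain ⟨e, he⟩ := Set.nonempty_iff_ne_empty.2 hne
        exact (h (hT he)).2 he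
      have h1 := hmin _ hss
      rw [edgeInduce_excess (hss.subset.trans hC)] at h1
      rw [hH, edgeInduce_excess hC, ← hH] at hge
      have c1 := Set.ncard_sdiff_add_ncard_of_subset hT fC
      have hVsub : V(G.edgeInduce (C \ T)) ⊆ V(H) \ U := by
        rintro v ⟨e, he, hev⟩
        exact ⟨⟨e, he.1, hev⟩, fun hvU => hno e he v hvU hev⟩
      have c2 := Set.ncard_le_ncard hVsub fVH.sdiff
      have c3 := Set.ncard_sdiff_add_ncard_of_subset hU fVH
      omega
    refine ⟨hC, le_antisymm ?_ hge, ?_, ?_, ?_⟩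
    · have hne : C.Nonempty := by
        rw [Set.nonempty_iff_ne_empty]
        intro h0
        rw [hH, h0, excess_empty] at hge
        omega
      obtain ⟨e, he⟩ := hne
      have h1 := excess_le_of_subset (Z := C \ {e}) hE hC Set.sdiff_subset
      have h2 := hmin (C \ {e}) ⟨Set.sdiff_subset, fun h => (h he).2 rfl⟩
      have h3 : (C \ (C \ {e})).ncard = 1 := by
        rw [Set.sdiff_sdiff_cancel_left (by simpa using he), Set.ncard_singleton]
      rw [h3] at h1
      push_cast at h1
      omega
    · rintro v ⟨⟨e, he, hev⟩, h⟩
      have : e ∈ H.incidenceSet v := edgeInduce_inc.2 ⟨hev, he⟩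
      rw [h] at this
      exact this
    · rintro v ⟨hv, h⟩
      rw [← hH] at hv h
      have hsub : H.incidenceSet v ⊆ C := hEH ▸ H.incidenceSet_subset_edgeSet v
      have h2 := hrem (H.incidenceSet v) hsub {v} (by simpa using hv)
        (by rw [Set.ncard_singleton]; rw [degree] at h; omega) (by
          rintro e ⟨he, hn⟩ u rfl hu
          exact hn (edgeInduce_inc.2 ⟨hu, he⟩))
      rw [(degree_eq_zero_iff fEH).2 h2] at h
      exact absurd h (by norm_num)
    · intro v hv hcyc
      rw [← hH] at hv hcyc
      rw [component_isCycleGraph_iff hv] at hcyc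
      set W := (fVH.subset (t := {w | w ∈ V(H) ∧ H.Reachable v w}) fun w h => h.1).toFinset
        with hW
      have memW : ∀ w, w ∈ W ↔ w ∈ V(H) ∧ H.Reachable v w := by intro v; simp [hW]
      set S := fC.toFinset.filter fun e => ∃ v ∈ W, H.Inc e v with hS
      have memS : ∀ e, e ∈ S ↔ ∃ v ∈ W, H.Inc e v := by
        intro e
        simp only [hS, Finset.mem_filter, Set.Finite.mem_toFinset, and_iff_right_iff_imp]
        rintro ⟨v, -, h⟩
        exact (edgeInduce_inc.1 h).2
      obtain ⟨-, d2⟩ := sum_degree W memS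
      have d3 := d2.1 (by
        intro e x y hxy hx
        exact (memW y).2 ⟨hxy.right_mem, ((memW x).1 hx).2.tail ⟨e, hxy⟩⟩)
      have d4 : ∑ w ∈ W, H.degree w = ∑ w ∈ W, 2 :=
        Finset.sum_congr rfl fun w hw => hcyc w ((memW w).1 hw).2
      have d5 : ∑ w ∈ W, 2 = 2 * W.card := by simp [mul_comm]
      have h2 := hrem S (by intro e he; simp [hS] at he; exact he.1) W
        (fun w hw => ((memW w).1 hw).1)
        (by rw [Set.ncard_coe_finset, Set.ncard_coe_finset]; omega) (by
          rintro e ⟨he, hn⟩ u hu hue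
          exact hn ((memS e).2 ⟨u, hu, edgeInduce_inc.2 ⟨hue, he⟩⟩))
      obtain ⟨e, he, hev⟩ := hv
      have : e ∈ (S : Set β) := (memS e).2 ⟨v, (memW v).2 ⟨⟨e, he, hev⟩, .refl⟩,
        edgeInduce_inc.2 ⟨hev, he⟩⟩
      rw [h2] at this
      exact this

/-- A set of edges contains no member of `C_k(G)` iff all its subsets have excess less than `k`. -/
lemma forall_notMem_kCircuits_iff (hE : E(G).Finite) (hk : 1 ≤ k) (hX : X ⊆ E(G)) :
    (∀ C ⊆ X, C ∉ G.kCircuits k) ↔ ∀ Y ⊆ X, (G.edgeInduce Y).excess < k := by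
  constructor
  · intro h Y hY
    by_contra hcon
    obtain ⟨C, hCY, hC⟩ := exists_minimal_excess hE (hY.trans hX) (not_lt.1 hcon)
    exact h C (hCY.trans hY) ((mem_kCircuits_iff hE hk (hCY.trans (hY.trans hX))).2 hC)
  · intro h C hC hmem
    have h1 := h C hC
    rw [hmem.2.1] at h1
    exact lt_irrefl _ h1

lemma kCircuits_aug (hE : E(G).Finite) {I J : Set β} (hI : I ⊆ E(G)) (hJ : J ⊆ E(G))
    (hIi : ∀ Y ⊆ I, (G.edgeInduce Y).excess < k) (hJi : ∀ Y ⊆ J, (G.edgeInduce Y).excess < k)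
    (hlt : I.ncard < J.ncard) :
    ∃ e ∈ J, e ∉ I ∧ ∀ Y ⊆ insert e I, (G.edgeInduce Y).excess < k := by
  by_contra! hcon
  have fI := hE.subset hI
  have fJ := hE.subset hJ
  have hcard : (I \ J).ncard < (J \ I).ncard := by
    have h1 := Set.ncard_inter_add_ncard_sdiff_eq_ncard I J fI
    have h2 := Set.ncard_inter_add_ncard_sdiff_eq_ncard J I fJ
    rw [Set.inter_comm] at h2
    omega
  have grow : ∀ T : Set β, T.Finite → T ⊆ J \ I →
      ∃ Y ⊆ I ∪ T, (k : ℤ) - 1 + T.ncard ≤ (G.edgeInduce Y).excess := by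
    intro T fT
    induction T, fT using Set.Finite.induction_on with
    | empty =>
      intro _
      obtain ⟨e, heJ, heI⟩ : (J \ I).Nonempty := by
        rw [← Set.ncard_pos fJ.sdiff]; omega
      obtain ⟨Y, hY, hk⟩ := hcon e heJ heI
      have hYE : Y ⊆ E(G) := hY.trans (Set.insert_subset (hJ heJ) hI)
      refine ⟨Y ∩ I, by simp, ?_⟩
      have h1 := excess_le_of_subset hE hYE (Set.inter_subset_left (s := Y) (t := I))
      have h2 : (Y \ (Y ∩ I)).ncard ≤ ({e} : Set β).ncard := by
        refine Set.ncard_le_ncard ?_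
        rintro x ⟨hx, hn⟩
        rcases hY hx with h | h
        · exact h
        · exact absurd ⟨hx, h⟩ hn
      rw [Set.ncard_singleton] at h2
      simp only [Set.ncard_empty]
      push_cast
      omega
    | @insert e T heT fT ih =>
      intro hsub
      obtain ⟨Y₁, hY₁, h1⟩ := ih ((Set.subset_insert _ _).trans hsub)
      have he := hsub (Set.mem_insert _ _)
      obtain ⟨Y₂, hY₂, h2⟩ := hcon e he.1 he.2
      have hT : T ⊆ J \ I := (Set.subset_insert _ _).trans hsub
      have s1 : Y₁ ⊆ E(G) := hY₁.trans (Set.union_subset hI fun x hx => hJ (hT hx).1)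
      have s2 : Y₂ ⊆ E(G) := hY₂.trans (Set.insert_subset (hJ he.1) hI)
      refine ⟨Y₁ ∪ Y₂, ?_, ?_⟩
      · refine Set.union_subset (hY₁.trans ?_) (hY₂.trans ?_)
        · exact Set.union_subset_union_right _ (Set.subset_insert _ _)
        · exact Set.insert_subset (Or.inr (Set.mem_insert _ _)) Set.subset_union_left
      · have h3 := excess_supermodular hE s1 s2
        have h4 := hIi (Y₁ ∩ Y₂) (by
          rintro x ⟨hx1, hx2⟩
          rcases hY₂ hx2 with rfl | h
          · rcases hY₁ hx1 with h | h
            · exact h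
            · exact absurd h heT
          · exact h)
        rw [Set.ncard_insert_of_notMem heT fT]
        push_cast
        omega
  obtain ⟨Y, hY, h1⟩ := grow (J \ I) fJ.sdiff subset_rfl
  have hYE : Y ⊆ E(G) := hY.trans (Set.union_subset hI (Set.sdiff_subset.trans hJ))
  have h2 := excess_le_of_subset hE hYE (Set.inter_subset_left (s := Y) (t := J))
  have h3 := hJi (Y ∩ J) Set.inter_subset_right
  have h4 : (Y \ (Y ∩ J)).ncard ≤ (I \ J).ncard := by
    refine Set.ncard_le_ncard ?_ fI.sdiff
    rintro x ⟨hx, hn⟩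
    have hxJ : x ∉ J := fun h => hn ⟨hx, h⟩
    rcases hY hx with h | h
    · exact ⟨h, hxJ⟩
    · exact absurd h.1 hxJ
  omega

end Aux

/-- The `k`-circular matroid `M_k(G)` of a graph `G` with finitely many edges, `k ≥ 1`: the matroid
on `E(G)` whose independent sets are the sets of edges that contain no member of `C_k(G)`. -/
def kCircularMatroid (G : Graph α β) (hE : E(G).Finite) (k : ℕ) (hk : 1 ≤ k) : Matroid β :=
  (IndepMatroid.ofFinite hE (fun I => I ⊆ E(G) ∧ ∀ C ⊆ I, C ∉ G.kCircuits k)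
    (by
      refine ⟨Set.empty_subset _, ?_⟩
      rw [forall_notMem_kCircuits_iff hE hk (Set.empty_subset _)]
      intro Y hY
      rw [Set.subset_empty_iff.1 hY, excess_empty]
      omega)
    (fun _ _ hJ hIJ => ⟨hIJ.trans hJ.1, fun C hC => hJ.2 C (hC.trans hIJ)⟩)
    (by
      rintro I J ⟨hI, hIi⟩ ⟨hJ, hJi⟩ hlt
      rw [forall_notMem_kCircuits_iff hE hk hI] at hIi
      rw [forall_notMem_kCircuits_iff hE hk hJ] at hJi
      obtain ⟨e, heJ, heI, h⟩ := kCircuits_aug hE hI hJ hIi hJi hlt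
      have hs : insert e I ⊆ E(G) := Set.insert_subset (hJ heJ) hI
      exact ⟨e, heJ, heI, hs, (forall_notMem_kCircuits_iff hE hk hs).2 h⟩)
    (fun _ h => h.1)).matroid

/-- The circuits of `M_k(G)` are exactly the members of `C_k(G)`. -/
lemma kCircularMatroid_isCircuit_iff (G : Graph α β) (hE : E(G).Finite) (k : ℕ) (hk : 1 ≤ k)
    (C : Set β) : (G.kCircularMatroid hE k hk).IsCircuit C ↔ C ∈ G.kCircuits k := by
  have hind : ∀ I, (G.kCircularMatroid hE k hk).Indep I ↔
      I ⊆ E(G) ∧ ∀ C ⊆ I, C ∉ G.kCircuits k := fun I => Iff.rfl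
  have hgr : (G.kCircularMatroid hE k hk).E = E(G) := rfl
  rw [Matroid.isCircuit_iff_forall_ssubset, Matroid.Dep, hind, hgr]
  constructor
  · rintro ⟨⟨h1, hCE⟩, h2⟩
    have : ∃ D ⊆ C, D ∈ G.kCircuits k := by
      by_contra! hcon
      exact h1 ⟨hCE, hcon⟩
    obtain ⟨D, hDC, hD⟩ := this
    rcases eq_or_ssubset_of_subset hDC with rfl | hss
    · exact hD
    · exact absurd hD (((hind D).1 (h2 hss)).2 D subset_rfl)
  · intro h
    refine ⟨⟨fun h1 => h1.2 C subset_rfl h, h.1⟩, fun I hI => (hind I).2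
      ⟨hI.subset.trans h.1, fun D hD hmem => ?_⟩⟩
    have h1 := ((mem_kCircuits_iff hE hk h.1).1 h).2 D (hD.trans_ssubset hI)
    rw [hmem.2.1] at h1
    exact lt_irrefl _ h1

end Graph

/-! In `M_k(G)` a nonempty union `X` of circuits has rank `|V(G⟨X⟩)| + k - 1`: supermodularity makes
the excess strictly increase whenever a circuit is added, so that `Δ(G⟨X⟩) = k - 1 + |X \ I|` for
every basis `I` of `X`. Deleting a vertex `x` therefore drops the rank by exactly one, and the
complement of `S(x, G)` is a hyperplane that is a union of circuits. Conversely, the rank formula in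
`G'` shows that such a hyperplane misses exactly one vertex of `G'` and is the complement of its
star. Hence the stars of `G` are stars of `G'`, and as `|V(G)| = |V(G')|` is read off from the rank
of the matroid, there are no others. -/

namespace KCircular

section Matroid

variable {β : Type*} {M : Matroid β} {X Y C : Set β} {e : β}

/-- A set is cyclic in `M` if it is a (possibly empty) union of circuits of `M`. -/
def IsCyclicSet (M : Matroid β) (X : Set β) : Prop :=
  ∀ e ∈ X, ∃ C ⊆ X, M.IsCircuit C ∧ e ∈ C

/-- A nonempty hyperplane of `M`, i.e. a flat of rank one less than the rank of `M`, that is a union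
of circuits. The complements of vertex stars are recognised among edge sets by this property. The
rank condition is stated additively and makes sense only if `M` has finite rank. -/
structure IsCyclicHyperplane (M : Matroid β) (H : Set β) : Prop where
  nonempty : H.Nonempty
  isCyclicSet : IsCyclicSet M H
  isFlat : M.IsFlat H
  eRk_add_one : M.eRk H + 1 = M.eRank

lemma isCyclicSet_of_isCircuit (hC : M.IsCircuit C) : IsCyclicSet M C :=
  fun _ he => ⟨C, subset_rfl, hC, he⟩

lemma IsCyclicSet.union (hX : IsCyclicSet M X) (hY : IsCyclicSet M Y) : IsCyclicSet M (X ∪ Y) := by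
  rintro e (he | he)
  · obtain ⟨C, hCX, hC⟩ := hX e he
    exact ⟨C, hCX.trans Set.subset_union_left, hC⟩
  · obtain ⟨C, hCY, hC⟩ := hY e he
    exact ⟨C, hCY.trans Set.subset_union_right, hC⟩

lemma IsCyclicSet.subset_ground (hX : IsCyclicSet M X) : X ⊆ M.E := fun e he =>
  let ⟨_, _, hC, heC⟩ := hX e he
  hC.subset_ground heC

lemma IsCyclicSet.insert_of_mem_closure (hX : IsCyclicSet M X) (he : e ∈ M.closure X) :
    IsCyclicSet M (insert e X) := by
  by_cases heX : e ∈ X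
  · rwa [Set.insert_eq_of_mem heX]
  obtain ⟨C, hCX, hC, heC⟩ := Matroid.exists_isCircuit_of_mem_closure he heX
  have insert_eq : insert e X = C ∪ X :=
    Set.Subset.antisymm (Set.insert_subset (Or.inl heC) Set.subset_union_right)
      (Set.union_subset hCX (Set.subset_insert e X))
  exact insert_eq ▸ (isCyclicSet_of_isCircuit hC).union hX

end Matroid

open Graph

variable {α α' β : Type*} {G : Graph α β} {G' : Graph α' β} {k : ℕ} {X D H I C : Set β}

section Deletion

lemma exists_inc_of_not_isIsolated {v : α} (hv : v ∈ V(G)) (h : ¬ G.IsIsolated v) :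
    ∃ e, G.Inc e v := by
  by_contra! hcon
  exact h ⟨hv, Set.eq_empty_of_forall_notMem hcon⟩

lemma edgeInduce_edgeSet_self (h : ∀ v, ¬ G.IsIsolated v) : G.edgeInduce E(G) = G := by
  refine Graph.ext (Set.ext fun v => ⟨fun ⟨_, _, hev⟩ => hev.vertex_mem, fun hv => ?_⟩)
    fun e x y => edgeInduce_isLink.trans (and_iff_left_of_imp IsLink.edge_mem)
  obtain ⟨e, he⟩ := exists_inc_of_not_isIsolated hv (h v)
  exact ⟨e, he.edge_mem, he⟩

lemma vertexSet_finite_of_edgeSet_finite (h : ∀ v, ¬ G.IsIsolated v) (hE : E(G).Finite) :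
    V(G).Finite :=
  edgeInduce_edgeSet_self h ▸ G.edgeInduce_vertexSet_finite hE

lemma deleteVerts_singleton_isLink {x y z : α} {e : β} :
    (G.deleteVerts {x}).IsLink e y z ↔ G.IsLink e y z ∧ e ∉ G.incidenceSet x := by
  simp only [deleteVerts_isLink, Set.mem_singleton_iff, mem_incidenceSet]
  refine and_congr_right fun hyz => ⟨?_, fun hx => ⟨?_, ?_⟩⟩
  · rintro ⟨hy, hz⟩ hx
    exact (hx.eq_or_eq_of_isLink hyz).elim (hy ·.symm) (hz ·.symm)
  · rintro rfl
    exact hx hyz.inc_left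
  · rintro rfl
    exact hx hyz.inc_right

lemma edgeInduce_edgeSet_sdiff_incidenceSet {x : α}
    (h : ∀ v, ¬ (G.deleteVerts {x}).IsIsolated v) :
    G.edgeInduce (E(G) \ G.incidenceSet x) = G.deleteVerts {x} := by
  have isLink_iff (e : β) (y z : α) : (G.edgeInduce (E(G) \ G.incidenceSet x)).IsLink e y z ↔
      (G.deleteVerts {x}).IsLink e y z := by
    rw [edgeInduce_isLink, deleteVerts_singleton_isLink, Set.mem_sdiff]
    exact and_congr_right fun hyz => and_iff_right hyz.edge_mem
  refine Graph.ext (Set.ext fun v => ⟨?_, fun hv => ?_⟩) isLink_iff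
  · rintro ⟨e, he, w, hw⟩
    exact ((isLink_iff e v w).1 (edgeInduce_isLink.2 ⟨hw, he⟩)).left_mem
  · obtain ⟨e, w, hw⟩ := exists_inc_of_not_isIsolated hv (h v)
    exact ((isLink_iff e v w).2 hw).left_mem

lemma injOn_incidenceSet_of_deleteVerts
    (h : ∀ x ∈ V(G), ∀ v, ¬ (G.deleteVerts {x}).IsIsolated v) :
    Set.InjOn G.incidenceSet V(G) := by
  intro x hx y hy hxy
  by_contra hne
  obtain ⟨e, w, hw⟩ := exists_inc_of_not_isIsolated (G := G.deleteVerts {x})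
    ⟨hy, fun h => hne h.symm⟩ (h x hx y)
  obtain ⟨hyw, hex⟩ := deleteVerts_singleton_isLink.1 hw
  exact hex (hxy ▸ hyw.inc_left)

end Deletion

section StrongIsomorphism

lemma vertexStars_eq_image (G : Graph α β) : G.vertexStars = G.incidenceSet '' V(G) := by
  ext S
  simp only [vertexStars, Set.mem_ofPred_eq, Set.mem_image, eq_comm]

lemma stronglyIsomorphic_of_incidenceSet_eq (hEE : E(G) = E(G')) (ν : V(G) ≃ V(G'))
    (hν : ∀ x : V(G), G'.incidenceSet (ν x) = G.incidenceSet x) : G.StronglyIsomorphic G' := by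
  have inc_iff (e : β) (x : V(G)) : G'.Inc e (ν x) ↔ G.Inc e x := Set.ext_iff.1 (hν x) e
  refine ⟨hEE, ν, fun e x y => ?_⟩
  have ends_iff : (∀ z, G.Inc e z → z = x ∨ z = y) ↔
      ∀ w, G'.Inc e w → w = ν x ∨ w = ν y := by
    constructor
    · intro h w hew
      obtain ⟨z, hz⟩ := ν.surjective ⟨w, hew.vertex_mem⟩
      obtain rfl : ν z = w := congrArg Subtype.val hz
      simpa only [Subtype.coe_inj, ν.apply_eq_iff_eq] using h z ((inc_iff e z).1 hew)
    · intro h z hez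
      lift z to V(G) using hez.vertex_mem
      simpa only [Subtype.coe_inj, ν.apply_eq_iff_eq] using h (ν z) ((inc_iff e z).2 hez)
  rw [isLink_iff_inc, isLink_iff_inc, inc_iff, inc_iff, ends_iff]

lemma stronglyIsomorphic_of_vertexStars_eq (hEE : E(G) = E(G'))
    (hS : G.vertexStars = G'.vertexStars) (hG : Set.InjOn G.incidenceSet V(G))
    (hG' : Set.InjOn G'.incidenceSet V(G')) : G.StronglyIsomorphic G' := by
  have hG'_bij : Set.BijOn G'.incidenceSet V(G') (G.incidenceSet '' V(G)) := by
    rw [← vertexStars_eq_image, hS, vertexStars_eq_image]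
    exact hG'.bijOn_image
  refine stronglyIsomorphic_of_incidenceSet_eq hEE
    ((hG.bijOn_image.equiv _).trans (hG'_bij.equiv _).symm) fun x => ?_
  exact congrArg Subtype.val ((hG'_bij.equiv _).apply_symm_apply (hG.bijOn_image.equiv _ x))

lemma vertexStars_eq_and_injOn_of_subset (hV' : V(G').Finite)
    (hcard : V(G').encard = V(G).encard) (hG : Set.InjOn G.incidenceSet V(G))
    (hS : G.vertexStars ⊆ G'.vertexStars) :
    G.vertexStars = G'.vertexStars ∧ Set.InjOn G'.incidenceSet V(G') := by
  have encard_eq : G.vertexStars.encard = V(G').encard := by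
    rw [vertexStars_eq_image, hG.encard_image, hcard]
  rw [vertexStars_eq_image G'] at hS ⊢
  have stars_eq : G.vertexStars = G'.incidenceSet '' V(G') :=
    (hV'.image _).eq_of_subset_of_encard_le' hS (encard_eq ▸ Set.encard_image_le _ _)
  exact ⟨stars_eq, hV'.injOn_of_encard_image_eq (stars_eq ▸ encard_eq)⟩

end StrongIsomorphism

section Rank

lemma excess_lt_excess_of_isCactiGraph (hE : E(G).Finite) (hX : X ⊆ E(G))
    (hpos : 0 < (G.edgeInduce X).excess) (hcacti : (G.edgeInduce X).IsCactiGraph) (hD : D ⊂ X) :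
    (G.edgeInduce D).excess < (G.edgeInduce X).excess := by
  -- `X` is a circuit of `M_m(G)` for `m = Δ(G⟨X⟩)`
  obtain ⟨m, hm⟩ := Int.eq_ofNat_of_zero_le hpos.le
  rw [hm]
  exact ((mem_kCircuits_iff hE (by omega) hX).1 ⟨hX, hm, hcacti⟩).2 D hD

lemma excess_lt_excess_union_of_mem_kCircuits (hE : E(G).Finite) (hk : 1 ≤ k) (hX : X ⊆ E(G))
    (hC : C ∈ G.kCircuits k) (hCX : ¬ C ⊆ X) :
    (G.edgeInduce X).excess < (G.edgeInduce (X ∪ C)).excess := by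
  have supermodular := excess_supermodular hE hX hC.1
  have inter_lt : (G.edgeInduce (X ∩ C)).excess < k :=
    ((mem_kCircuits_iff hE hk hC.1).1 hC).2 _
      (Set.inter_subset_right.ssubset_of_ne fun h => hCX (Set.inter_eq_right.1 h))
  have excess_eq : (G.edgeInduce C).excess = k := hC.2.1
  omega

variable {hE : E(G).Finite} {hk : 1 ≤ k}

lemma excess_lt_of_indep (hI : (G.kCircularMatroid hE k hk).Indep I) :
    (G.edgeInduce I).excess < k :=
  (forall_notMem_kCircuits_iff hE hk hI.subset_ground).1 hI.2 I subset_rfl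

lemma excess_le_of_isBasis (hI : (G.kCircularMatroid hE k hk).IsBasis I X) :
    (G.edgeInduce X).excess ≤ k - 1 + (X \ I).ncard := by
  have := excess_lt_of_indep hI.indep
  have := excess_le_of_subset hE hI.subset_ground hI.subset
  omega

lemma IsCyclicSet.excess_le_excess (hX : IsCyclicSet (G.kCircularMatroid hE k hk) X) (hD : D ⊆ X) :
    (G.edgeInduce D).excess ≤ (G.edgeInduce X).excess := by
  have hXE : X ⊆ E(G) := hX.subset_ground
  obtain ⟨N, hNX, hmax⟩ := Set.exists_max_image {N | N ⊆ X} (fun N => (G.edgeInduce N).excess)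
    (hE.subset hXE).finite_subsets ⟨D, hD⟩
  suffices N = X from this ▸ hmax D hD
  refine subset_antisymm hNX fun e he => ?_
  obtain ⟨C, hCX, hC, heC⟩ := hX e he
  by_contra heN
  have := excess_lt_excess_union_of_mem_kCircuits hE hk (hNX.trans hXE)
    ((kCircularMatroid_isCircuit_iff G hE k hk C).1 hC) fun h => heN (h heC)
  exact this.not_ge (hmax _ (Set.union_subset hNX hCX))

lemma exists_isCyclicSet_le_excess {T : Finset β} (hne : T.Nonempty)
    (hT : ∀ e ∈ T, e ∈ (G.kCircularMatroid hE k hk).closure I \ I) :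
    ∃ Y ⊆ I ∪ T, IsCyclicSet (G.kCircularMatroid hE k hk) Y ∧
      (k : ℤ) - 1 + T.card ≤ (G.edgeInduce Y).excess := by
  have exists_circuit (e : β) (he : e ∈ (G.kCircularMatroid hE k hk).closure I \ I) :
      ∃ C ⊆ insert e I, (G.kCircularMatroid hE k hk).IsCircuit C ∧ e ∈ C :=
    Matroid.exists_isCircuit_of_mem_closure he.1 he.2
  induction hne using Finset.Nonempty.cons_induction with
  | singleton e =>
    obtain ⟨C, hCI, hC, -⟩ := exists_circuit e (hT e (Finset.mem_singleton_self e))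
    refine ⟨C, by simpa using hCI, isCyclicSet_of_isCircuit hC, ?_⟩
    simp [((kCircularMatroid_isCircuit_iff G hE k hk C).1 hC).2.1]
  | cons e T heT _ ih =>
    rw [Finset.forall_mem_cons] at hT
    obtain ⟨Y, hYT, hY, hYex⟩ := ih hT.2
    obtain ⟨C, hCI, hC, heC⟩ := exists_circuit e hT.1
    have heY : e ∉ Y := fun h => (hYT h).elim hT.1.2 heT
    refine ⟨Y ∪ C, ?_, hY.union (isCyclicSet_of_isCircuit hC), ?_⟩
    · rw [Finset.coe_cons, Set.union_insert]
      exact Set.union_subset (hYT.trans (Set.subset_insert _ _))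
        (hCI.trans (Set.insert_subset_insert Set.subset_union_left))
    · have := excess_lt_excess_union_of_mem_kCircuits hE hk hY.subset_ground
        ((kCircularMatroid_isCircuit_iff G hE k hk C).1 hC) fun h => heY (h heC)
      rw [Finset.card_cons]
      push_cast
      omega

lemma exists_isCyclicSet_subset_le_excess (hI : (G.kCircularMatroid hE k hk).IsBasis I X)
    (hne : (X \ I).Nonempty) :
    ∃ Y ⊆ X, IsCyclicSet (G.kCircularMatroid hE k hk) Y ∧
      (k : ℤ) - 1 + (X \ I).ncard ≤ (G.edgeInduce Y).excess := by
  have hfin : (X \ I).Finite := (hE.subset hI.subset_ground).sdiff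
  obtain ⟨Y, hYX, hY⟩ := exists_isCyclicSet_le_excess (hfin.toFinset_nonempty.2 hne)
    fun e he => Set.sdiff_subset_sdiff_left hI.subset_closure (hfin.mem_toFinset.1 he)
  rw [hfin.coe_toFinset, Set.union_sdiff_cancel hI.subset] at hYX
  rw [← Set.ncard_eq_toFinset_card _ hfin] at hY
  exact ⟨Y, hYX, hY⟩

lemma isCyclicSet_of_isCactiGraph (hX : X ⊆ E(G)) (hex : (k : ℤ) ≤ (G.edgeInduce X).excess)
    (hcacti : (G.edgeInduce X).IsCactiGraph) : IsCyclicSet (G.kCircularMatroid hE k hk) X := by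
  obtain ⟨I, hI⟩ := (G.kCircularMatroid hE k hk).exists_isBasis X hX
  have excess_le := excess_le_of_isBasis hI
  have hne : (X \ I).Nonempty := by
    rw [← Set.ncard_pos (hE.subset hX).sdiff]
    omega
  obtain ⟨Y, hYX, hY, hYex⟩ := exists_isCyclicSet_subset_le_excess hI hne
  obtain rfl | hYX := hYX.eq_or_ssubset
  · exact hY
  · have := excess_lt_excess_of_isCactiGraph hE hX (by omega) hcacti hYX
    omega

lemma nonempty_of_one_le_excess (h : 1 ≤ (G.edgeInduce X).excess) : X.Nonempty := by
  rw [Set.nonempty_iff_ne_empty]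
  rintro rfl
  rw [excess_empty] at h
  omega

lemma IsCyclicSet.excess_eq (hX : IsCyclicSet (G.kCircularMatroid hE k hk) X) (hne : X.Nonempty)
    (hI : (G.kCircularMatroid hE k hk).IsBasis I X) :
    (G.edgeInduce X).excess = k - 1 + (X \ I).ncard := by
  refine (excess_le_of_isBasis hI).antisymm ?_
  have hXI : (X \ I).Nonempty := by
    obtain ⟨e, he⟩ := hne
    obtain ⟨C, hCX, hC, -⟩ := hX e he
    exact Set.sdiff_nonempty.2 fun hXI => hC.not_indep (hI.indep.subset (hCX.trans hXI))
  obtain ⟨Y, hYX, -, hYex⟩ := exists_isCyclicSet_subset_le_excess hI hXI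
  exact hYex.trans (hX.excess_le_excess hYX)

lemma eRk_add_one_le (hX : X ⊆ E(G)) :
    (G.kCircularMatroid hE k hk).eRk X + 1 ≤ V(G.edgeInduce X).encard + k := by
  obtain ⟨I, hI⟩ := (G.kCircularMatroid hE k hk).exists_isBasis X hX
  have hIE : I ⊆ E(G) := hI.indep.subset_ground
  have excess_lt := excess_lt_of_indep hI.indep
  have ncard_le := Set.ncard_le_ncard (edgeInduce_vertexSet_mono (G := G) hI.subset)
    (G.edgeInduce_vertexSet_finite (hE.subset hX))
  rw [edgeInduce_excess hIE] at excess_lt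
  rw [hI.eRk_eq_encard, ← (hE.subset hIE).cast_ncard_eq,
    ← (G.edgeInduce_vertexSet_finite (hE.subset hX)).cast_ncard_eq]
  norm_cast
  omega

lemma IsCyclicSet.eRk_add_one (hX : IsCyclicSet (G.kCircularMatroid hE k hk) X)
    (hne : X.Nonempty) :
    (G.kCircularMatroid hE k hk).eRk X + 1 = V(G.edgeInduce X).encard + k := by
  have hXE : X ⊆ E(G) := hX.subset_ground
  obtain ⟨I, hI⟩ := (G.kCircularMatroid hE k hk).exists_isBasis X hXE
  have excess_eq := hX.excess_eq hne hI
  have ncard_sdiff := Set.ncard_sdiff_add_ncard_of_subset hI.subset (hE.subset hXE)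
  rw [edgeInduce_excess hXE] at excess_eq
  rw [hI.eRk_eq_encard, ← (hE.subset (hI.subset.trans hXE)).cast_ncard_eq,
    ← (G.edgeInduce_vertexSet_finite (hE.subset hXE)).cast_ncard_eq]
  norm_cast
  omega

lemma eRank_add_one (hiso : ∀ v, ¬ G.IsIsolated v)
    (hcyc : IsCyclicSet (G.kCircularMatroid hE k hk) E(G)) (hne : E(G).Nonempty) :
    (G.kCircularMatroid hE k hk).eRank + 1 = V(G).encard + k := by
  rw [← Matroid.eRk_ground]
  exact (hcyc.eRk_add_one hne).trans (by rw [edgeInduce_edgeSet_self hiso])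

lemma IsCyclicSet.mem_closure_iff (hX : IsCyclicSet (G.kCircularMatroid hE k hk) X)
    (hne : X.Nonempty) {e : β} : e ∈ (G.kCircularMatroid hE k hk).closure X ↔
      e ∈ E(G) ∧ ∀ v, G.Inc e v → v ∈ V(G.edgeInduce X) := by
  set M := G.kCircularMatroid hE k hk
  have hXE : X ⊆ M.E := hX.subset_ground
  have hXM : M.IsRkFinite X := M.isRkFinite_of_finite (hE.subset hXE)
  refine ⟨fun he => ⟨M.mem_ground_of_mem_closure he, fun v hv => ?_⟩, fun ⟨he, hends⟩ => ?_⟩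
  · have hins : IsCyclicSet M (insert e X) := hX.insert_of_mem_closure he
    have encard_eq : V(G.edgeInduce (insert e X)).encard = V(G.edgeInduce X).encard := by
      refine ENat.add_left_injective_of_ne_top (ENat.natCast_ne_top k) ?_
      simp only [← hins.eRk_add_one (Set.insert_nonempty e X), ← hX.eRk_add_one hne]
      rw [← M.eRk_closure_eq, Matroid.closure_insert_eq_of_mem_closure he, M.eRk_closure_eq]
    rw [(G.edgeInduce_vertexSet_finite (hE.subset hXE)).eq_of_subset_of_encard_le
      (edgeInduce_vertexSet_mono (Set.subset_insert e X)) encard_eq.le]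
    exact ⟨e, Set.mem_insert e X, hv⟩
  · have vertexSet_subset : V(G.edgeInduce (insert e X)) ⊆ V(G.edgeInduce X) := by
      rintro v ⟨f, rfl | hf, hv⟩
      exacts [hends v hv, ⟨f, hf, hv⟩]
    have eRk_le : M.eRk (insert e X) ≤ M.eRk X := by
      refine (ENat.add_le_add_iff_right ENat.one_ne_top).1 ?_
      calc M.eRk (insert e X) + 1
        _ ≤ V(G.edgeInduce (insert e X)).encard + k := eRk_add_one_le (Set.insert_subset he hXE)
        _ ≤ V(G.edgeInduce X).encard + k := by gcongr
        _ = M.eRk X + 1 := (hX.eRk_add_one hne).symm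
    rw [hXM.closure_eq_closure_of_subset_of_eRk_ge_eRk (Set.subset_insert e X) eRk_le]
    exact M.mem_closure_of_mem' (Set.mem_insert e X) he

end Rank

section Stars

variable {hE : E(G).Finite} {hk : 1 ≤ k}

lemma isFlat_edgeSet_sdiff_incidenceSet {x : α}
    (hcyc : IsCyclicSet (G.kCircularMatroid hE k hk) (E(G) \ G.incidenceSet x))
    (hne : (E(G) \ G.incidenceSet x).Nonempty) :
    (G.kCircularMatroid hE k hk).IsFlat (E(G) \ G.incidenceSet x) := by
  rw [Matroid.isFlat_iff_closure_eq]
  refine (Matroid.subset_closure _ _ hcyc.subset_ground).antisymm' fun e he => ?_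
  obtain ⟨heE, hends⟩ := (hcyc.mem_closure_iff hne).1 he
  refine ⟨heE, fun hex => ?_⟩
  obtain ⟨f, hf, hfx⟩ := hends x hex
  exact hf.2 hfx

lemma isCyclicHyperplane_edgeSet_sdiff_incidenceSet (hiso : ∀ v, ¬ G.IsIsolated v)
    (hcyc : IsCyclicSet (G.kCircularMatroid hE k hk) E(G)) {x : α} (hx : x ∈ V(G))
    (hex : (k : ℤ) ≤ (G.deleteVerts {x}).excess) (hcacti : (G.deleteVerts {x}).IsCactiGraph) :
    IsCyclicHyperplane (G.kCircularMatroid hE k hk) (E(G) \ G.incidenceSet x) := by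
  have edgeInduce_eq := edgeInduce_edgeSet_sdiff_incidenceSet hcacti.1
  rw [← edgeInduce_eq] at hex hcacti
  have hne : (E(G) \ G.incidenceSet x).Nonempty := nonempty_of_one_le_excess (G := G) (by omega)
  have hH : IsCyclicSet (G.kCircularMatroid hE k hk) (E(G) \ G.incidenceSet x) :=
    isCyclicSet_of_isCactiGraph Set.sdiff_subset hex hcacti
  refine ⟨hne, hH, isFlat_edgeSet_sdiff_incidenceSet hH hne, ?_⟩
  refine ENat.add_left_injective_of_ne_top ENat.one_ne_top ?_
  calc (G.kCircularMatroid hE k hk).eRk (E(G) \ G.incidenceSet x) + 1 + 1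
    _ = (V(G) \ {x}).encard + 1 + k := by
      rw [hH.eRk_add_one hne, edgeInduce_eq, vertexSet_deleteVerts, add_right_comm]
    _ = V(G).encard + k := by rw [Set.encard_sdiff_singleton_add_one hx]
    _ = (G.kCircularMatroid hE k hk).eRank + 1 :=
      (eRank_add_one hiso hcyc (hne.mono Set.sdiff_subset)).symm

lemma IsCyclicHyperplane.exists_vertexSet_sdiff_eq_singleton (hiso : ∀ v, ¬ G.IsIsolated v)
    (hcyc : IsCyclicSet (G.kCircularMatroid hE k hk) E(G))
    (hH : IsCyclicHyperplane (G.kCircularMatroid hE k hk) H) :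
    ∃ x, V(G) \ V(G.edgeInduce H) = {x} := by
  have hHE : H ⊆ E(G) := hH.isCyclicSet.subset_ground
  have encard_eq : V(G.edgeInduce H).encard + 1 = V(G).encard := by
    refine ENat.add_left_injective_of_ne_top (ENat.natCast_ne_top k) ?_
    simp only [← eRank_add_one hiso hcyc (hH.nonempty.mono hHE), ← hH.eRk_add_one]
    rw [hH.isCyclicSet.eRk_add_one hH.nonempty, add_right_comm]
  have vertexSet_subset : V(G.edgeInduce H) ⊆ V(G) := fun _ ⟨_, _, hv⟩ => hv.vertex_mem
  rw [← Set.encard_sdiff_add_encard_of_subset vertexSet_subset, add_comm] at encard_eq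
  have vertexSet_finite := G.edgeInduce_vertexSet_finite (hE.subset hHE)
  exact Set.encard_eq_one.1
    (ENat.add_left_injective_of_ne_top vertexSet_finite.encard_lt_top.ne encard_eq.symm)

lemma IsCyclicHyperplane.edgeSet_sdiff_mem_vertexStars (hiso : ∀ v, ¬ G.IsIsolated v)
    (hcyc : IsCyclicSet (G.kCircularMatroid hE k hk) E(G))
    (hH : IsCyclicHyperplane (G.kCircularMatroid hE k hk) H) : E(G) \ H ∈ G.vertexStars := by
  obtain ⟨x, hx⟩ := hH.exists_vertexSet_sdiff_eq_singleton hiso hcyc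
  have hx_mem : x ∈ V(G) \ V(G.edgeInduce H) := hx ▸ Set.mem_singleton x
  refine ⟨x, hx_mem.1, Set.Subset.antisymm (fun e ⟨heE, heH⟩ => ?_)
    fun e hex => ⟨hex.edge_mem, fun heH => ?_⟩⟩
  · rw [← hH.isFlat.closure, hH.isCyclicSet.mem_closure_iff hH.nonempty] at heH
    push Not at heH
    obtain ⟨v, hev, hv⟩ := heH heE
    obtain rfl : v = x := hx.subset ⟨hev.vertex_mem, hv⟩
    exact hev
  · exact hx_mem.2 ⟨e, heH, hex⟩

end Stars

end KCircular

open KCircular in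
theorem mainTheorem11_general {α α' β : Type*} (G : Graph α β) (G' : Graph α' β)
    (hE : E(G).Finite) (hE' : E(G').Finite) (hiso' : ∀ v, ¬ G'.IsIsolated v)
    (k : ℕ) (hk : 1 ≤ k) (h1 : (k : ℤ) ≤ G.excess ∧ G.IsCactiGraph)
    (h2 : ∀ x ∈ V(G), (k : ℤ) ≤ (G.deleteVerts {x}).excess ∧ (G.deleteVerts {x}).IsCactiGraph)
    (h3 : G'.kCircularMatroid hE' k hk = G.kCircularMatroid hE k hk) :
    G.vertexStars = G'.vertexStars ∧ G.StronglyIsomorphic G' := by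
  obtain ⟨hex, hcacti⟩ := h1
  have hEE : E(G') = E(G) := congrArg Matroid.E h3
  have edgeInduce_eq := edgeInduce_edgeSet_self hcacti.1
  have hne : E(G).Nonempty := nonempty_of_one_le_excess (G := G) (by rw [edgeInduce_eq]; omega)
  have hcyc : IsCyclicSet (G.kCircularMatroid hE k hk) E(G) :=
    isCyclicSet_of_isCactiGraph subset_rfl (by rwa [edgeInduce_eq]) (by rwa [edgeInduce_eq])
  have hcyc' : IsCyclicSet (G'.kCircularMatroid hE' k hk) E(G') := by rwa [h3, hEE]
  have encard_eq : V(G').encard = V(G).encard := by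
    refine ENat.add_left_injective_of_ne_top (ENat.natCast_ne_top k) ?_
    simp only [← eRank_add_one hcacti.1 hcyc hne, ← eRank_add_one hiso' hcyc' (hEE ▸ hne), h3]
  have stars_subset : G.vertexStars ⊆ G'.vertexStars := by
    rintro _ ⟨x, hx, rfl⟩
    have hH : IsCyclicHyperplane (G'.kCircularMatroid hE' k hk) (E(G) \ G.incidenceSet x) :=
      h3 ▸ isCyclicHyperplane_edgeSet_sdiff_incidenceSet hcacti.1 hcyc hx (h2 x hx).1 (h2 x hx).2
    simpa only [hEE, Set.sdiff_sdiff_cancel_left (G.incidenceSet_subset_edgeSet x)] using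
      hH.edgeSet_sdiff_mem_vertexStars hiso' hcyc'
  have hinj := injOn_incidenceSet_of_deleteVerts fun x hx => (h2 x hx).2.1
  obtain ⟨stars_eq, hinj'⟩ := vertexStars_eq_and_injOn_of_subset
    (vertexSet_finite_of_edgeSet_finite hiso' hE') encard_eq hinj stars_subset
  exact ⟨stars_eq, stronglyIsomorphic_of_vertexStars_eq hEE.symm stars_eq hinj hinj'⟩

theorem mainTheorem11 {α α' β : Type*} (G : Graph α β) (G' : Graph α' β)
    (hV : V(G).Finite) (hE : E(G).Finite) (hV' : V(G').Finite) (hE' : E(G').Finite)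
    (hiso' : ∀ v, ¬ G'.IsIsolated v)
    (k : ℕ) (hk : 2 ≤ k)
    (h1 : (k : ℤ) ≤ G.excess ∧ G.IsCactiGraph)
    (h2 : ∀ x ∈ V(G), (k : ℤ) ≤ (G.deleteVerts {x}).excess ∧ (G.deleteVerts {x}).IsCactiGraph)
    (h3 : G'.kCircularMatroid hE' k (one_le_two.trans hk) =
      G.kCircularMatroid hE k (one_le_two.trans hk)) :
    G.vertexStars = G'.vertexStars ∧ G.StronglyIsomorphic G' :=
  mainTheorem11_general G G' hE hE' hiso' k (one_le_two.trans hk) h1 h2 h3
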